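/- Let $A$ be a Banach algebra (over $\mathbb{R}$ or $\mathbb{C}$, not necessarily unital). Equip the second dual $A^{**}$ with the first Arens product $\Box$, given for $\Phi,\Psi\in A^{**}$, $f\in A^*$, $a,b\in A$ by $$(f\cdot a)(b)=f(ab),\qquad (\Psi\cdot f)(a)=\Psi(f\cdot a),\qquad (\Phi\,\Box\,\Psi)(f)=\Phi(\Psi\cdot f),$$ so that $A^{**}$ is again a Banach algebra, and equip $A^{****}=(A^{**})^{**}$ with the first Arens product built from $(A^{**},\Box)$. Suppose that (i) $A^{**}$ is amenable, i.e. for every Banach $A^{**}$-bimodule $X$, every bounded derivation $D\colon A^{**}\to X^*$ (a bounded linear map with $D(ab)=D(a)\cdot b+a\cdot D(b)$) is inner, i.e. of the form $D(a)=a\cdot\varphi-\varphi\cdot a$ for some $\varphi\in X^*$, where $X^*$ carries the dual actions $(a\cdot f)(x)=f(x\cdot a)$ and $(f\cdot a)(x)=f(a\cdot x)$; (ii) $A^{**}$ is Arens regular, i.e. the first Arens product on $A^{****}$ coincides with the second Arens product $\Diamond$, which is given for $\Phi,\Psi\in A^{****}$, $f\in A^{***}$, $a,b\in A^{**}$ by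 $(a\cdot f)(b)=f(ba)$, $(f\cdot\Phi)(a)=\Phi(a\cdot f)$, $(\Phi\Diamond\Psi)(f)=\Psi(f\cdot\Phi)$; (iii) the canonical image of $A^{**}$ in $A^{****}$ is a two-sided ideal of $A^{****}$. Then $A$ is reflexive, i.e. the canonical embedding $A\to A^{**}$ is surjective. -/

import Mathlib

universe u v

set_option maxSynthPendingDepth 3

noncomputable section

namespace ArensProduct

section Bilinear

variable {𝕜 : Type*} [RCLike 𝕜]
  {E F G : Type*} [NormedAddCommGroup E] [NormedSpace 𝕜 E]
  [NormedAddCommGroup F] [NormedSpace 𝕜 F] [NormedAddCommGroup G] [NormedSpace 𝕜 G]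

/-- The adjoint `m* : G* × E → F*` of a bounded bilinear map `m : E × F → G`,
`m*(g, x)(y) = g (m (x, y))`. -/
def adjoint (m : E →L[𝕜] F →L[𝕜] G) : StrongDual 𝕜 G →L[𝕜] E →L[𝕜] StrongDual 𝕜 F :=
  ((ContinuousLinearMap.compL 𝕜 F G 𝕜).flip.comp m).flip

theorem adjoint_apply (m : E →L[𝕜] F →L[𝕜] G) (g : StrongDual 𝕜 G) (x : E) (y : F) :
    adjoint m g x y = g (m x y) := rfl

theorem norm_adjoint_le (m : E →L[𝕜] F →L[𝕜] G) : ‖adjoint m‖ ≤ ‖m‖ := by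
  unfold adjoint
  rw [ContinuousLinearMap.opNorm_flip]
  refine (ContinuousLinearMap.opNorm_comp_le _ _).trans ?_
  rw [ContinuousLinearMap.opNorm_flip]
  exact mul_le_of_le_one_left (norm_nonneg _) (ContinuousLinearMap.norm_compL_le 𝕜 F G 𝕜)

/-- The first Arens extension `m*** : E** × F** → G**` of `m : E × F → G`. -/
def firstExt (m : E →L[𝕜] F →L[𝕜] G) :
    StrongDual 𝕜 (StrongDual 𝕜 E) →L[𝕜] StrongDual 𝕜 (StrongDual 𝕜 F) →L[𝕜]
      StrongDual 𝕜 (StrongDual 𝕜 G) :=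
  adjoint (adjoint (adjoint m))

/-- The second Arens extension of `m`: transpose, take the first extension, transpose back. -/
def secondExt (m : E →L[𝕜] F →L[𝕜] G) :
    StrongDual 𝕜 (StrongDual 𝕜 E) →L[𝕜] StrongDual 𝕜 (StrongDual 𝕜 F) →L[𝕜]
      StrongDual 𝕜 (StrongDual 𝕜 G) :=
  (firstExt m.flip).flip

theorem norm_firstExt_le (m : E →L[𝕜] F →L[𝕜] G) : ‖firstExt m‖ ≤ ‖m‖ :=
  (norm_adjoint_le _).trans ((norm_adjoint_le _).trans (norm_adjoint_le _))

end Bilinear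

end ArensProduct

/-- The second dual `A**` of a normed space. For a Banach algebra `A` it carries the first Arens
product (below). -/
def Bidual (𝕜 : Type v) [RCLike 𝕜] (A : Type u) [NormedAddCommGroup A] [NormedSpace 𝕜 A] :
    Type (max u v) :=
  StrongDual 𝕜 (StrongDual 𝕜 A)

namespace Bidual

section Space

variable (𝕜 : Type v) [RCLike 𝕜] (A : Type u) [NormedAddCommGroup A] [NormedSpace 𝕜 A]

instance instNormedAddCommGroup : NormedAddCommGroup (Bidual 𝕜 A) :=
  inferInstanceAs (NormedAddCommGroup (StrongDual 𝕜 (StrongDual 𝕜 A)))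

instance instNormedSpace : NormedSpace 𝕜 (Bidual 𝕜 A) :=
  inferInstanceAs (NormedSpace 𝕜 (StrongDual 𝕜 (StrongDual 𝕜 A)))

instance instCompleteSpace : CompleteSpace (Bidual 𝕜 A) :=
  inferInstanceAs (CompleteSpace (StrongDual 𝕜 (StrongDual 𝕜 A)))

/-- The canonical embedding `A → A**`, `a ↦ (f ↦ f a)`. -/
def incl : A →L[𝕜] Bidual 𝕜 A := NormedSpace.inclusionInDoubleDual 𝕜 A

end Space

section Algebra

variable (𝕜 : Type v) [RCLike 𝕜] (A : Type u) [NonUnitalNormedRing A] [NormedSpace 𝕜 A]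
  [IsScalarTower 𝕜 A A] [SMulCommClass 𝕜 A A]

/-- The first Arens product on `A**`: with `(f·a)(b) = f(ab)` and `(Ψ·f)(a) = Ψ(f·a)`, it is
`(Φ □ Ψ)(f) = Φ(Ψ·f)`. -/
def firstMul : Bidual 𝕜 A →L[𝕜] Bidual 𝕜 A →L[𝕜] Bidual 𝕜 A :=
  ArensProduct.firstExt (ContinuousLinearMap.mul 𝕜 A)

/-- The second Arens product on `A**`: with `(a·f)(b) = f(ba)` and `(f·Φ)(a) = Φ(a·f)`, it is
`(Φ ◇ Ψ)(f) = Ψ(f·Φ)`. -/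
def secondMul : Bidual 𝕜 A →L[𝕜] Bidual 𝕜 A →L[𝕜] Bidual 𝕜 A :=
  ArensProduct.secondExt (ContinuousLinearMap.mul 𝕜 A)

theorem firstMul_assoc (Φ Ψ Θ : Bidual 𝕜 A) :
    firstMul 𝕜 A (firstMul 𝕜 A Φ Ψ) Θ = firstMul 𝕜 A Φ (firstMul 𝕜 A Ψ Θ) := by
  have key : ∀ f : StrongDual 𝕜 A,
      ArensProduct.adjoint (ArensProduct.adjoint (ContinuousLinearMap.mul 𝕜 A)) Ψ
        (ArensProduct.adjoint (ArensProduct.adjoint (ContinuousLinearMap.mul 𝕜 A)) Θ f) =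
      ArensProduct.adjoint (ArensProduct.adjoint (ContinuousLinearMap.mul 𝕜 A))
        (ArensProduct.firstExt (ContinuousLinearMap.mul 𝕜 A) Ψ Θ) f := by
    intro f
    ext a
    refine congrArg (DFunLike.coe (F := StrongDual 𝕜 (StrongDual 𝕜 A)) Ψ) ?_
    ext b
    refine congrArg (DFunLike.coe (F := StrongDual 𝕜 (StrongDual 𝕜 A)) Θ) ?_
    ext c
    exact congrArg f (mul_assoc a b c)
  exact ContinuousLinearMap.ext fun f =>
    congrArg (DFunLike.coe (F := StrongDual 𝕜 (StrongDual 𝕜 A)) Φ) (key f)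

theorem norm_firstMul_le (Φ Ψ : Bidual 𝕜 A) : ‖firstMul 𝕜 A Φ Ψ‖ ≤ ‖Φ‖ * ‖Ψ‖ := by
  have h : ‖firstMul 𝕜 A‖ ≤ 1 :=
    (ArensProduct.norm_firstExt_le _).trans (ContinuousLinearMap.opNorm_mul_le 𝕜 A)
  refine ((firstMul 𝕜 A).le_opNorm₂ Φ Ψ).trans ?_
  rw [mul_assoc]
  exact mul_le_of_le_one_left (by positivity) h

/-- `A**` as a Banach algebra: the product is the first Arens product. -/
instance instNonUnitalNormedRing : NonUnitalNormedRing (Bidual 𝕜 A) where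
  __ := instNormedAddCommGroup 𝕜 A
  mul Φ Ψ := firstMul 𝕜 A Φ Ψ
  left_distrib Φ Ψ Θ := map_add (firstMul 𝕜 A Φ) Ψ Θ
  right_distrib Φ Ψ Θ := (firstMul 𝕜 A).map_add₂ Φ Ψ Θ
  zero_mul Φ := (firstMul 𝕜 A).map_zero₂ Φ
  mul_zero Φ := map_zero (firstMul 𝕜 A Φ)
  mul_assoc := firstMul_assoc 𝕜 A
  norm_mul_le := norm_firstMul_le 𝕜 A

instance instIsScalarTower : IsScalarTower 𝕜 (Bidual 𝕜 A) (Bidual 𝕜 A) :=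
  ⟨fun c Φ Ψ => (firstMul 𝕜 A).map_smul₂ c Φ Ψ⟩

instance instSMulCommClass : SMulCommClass 𝕜 (Bidual 𝕜 A) (Bidual 𝕜 A) :=
  ⟨fun c Φ Ψ => (map_smul (firstMul 𝕜 A Φ) c Ψ).symm⟩

end Algebra

end Bidual

/-- A Banach `A`-bimodule structure on `X`: jointly bounded bilinear left and right actions
`lact a x = a·x`, `ract a x = x·a`. -/
structure BanachBimodule (𝕜 : Type*) [RCLike 𝕜]
    (A : Type*) [NonUnitalNormedRing A] [NormedSpace 𝕜 A]
    (X : Type*) [NormedAddCommGroup X] [NormedSpace 𝕜 X] where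
  lact : A →L[𝕜] X →L[𝕜] X
  ract : A →L[𝕜] X →L[𝕜] X
  lact_mul : ∀ (a b : A) (x : X), lact (a * b) x = lact a (lact b x)
  ract_mul : ∀ (a b : A) (x : X), ract (a * b) x = ract b (ract a x)
  lact_ract : ∀ (a b : A) (x : X), lact a (ract b x) = ract b (lact a x)

namespace BanachBimodule

variable {𝕜 : Type*} [RCLike 𝕜]
  {A : Type*} [NonUnitalNormedRing A] [NormedSpace 𝕜 A]
  {X : Type*} [NormedAddCommGroup X] [NormedSpace 𝕜 X]

/-- The dual bimodule `X*`: `(a·f)(x) = f(x·a)` and `(f·a)(x) = f(a·x)`. -/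
def dual (M : BanachBimodule 𝕜 A X) : BanachBimodule 𝕜 A (StrongDual 𝕜 X) where
  lact := (ArensProduct.adjoint M.ract).flip
  ract := (ArensProduct.adjoint M.lact).flip
  lact_mul a b f := ContinuousLinearMap.ext fun x => congrArg f (M.ract_mul a b x)
  ract_mul a b f := ContinuousLinearMap.ext fun x => congrArg f (M.lact_mul a b x)
  lact_ract a b f := ContinuousLinearMap.ext fun x => congrArg f (M.lact_ract b a x)

theorem dual_lact_apply (M : BanachBimodule 𝕜 A X) (a : A) (f : StrongDual 𝕜 X) (x : X) :
    M.dual.lact a f x = f (M.ract a x) := rfl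

theorem dual_ract_apply (M : BanachBimodule 𝕜 A X) (a : A) (f : StrongDual 𝕜 X) (x : X) :
    M.dual.ract a f x = f (M.lact a x) := rfl

/-- `D(ab) = D(a)·b + a·D(b)`. -/
def IsDerivation (M : BanachBimodule 𝕜 A X) (D : A →L[𝕜] X) : Prop :=
  ∀ a b : A, D (a * b) = M.ract b (D a) + M.lact a (D b)

/-- `D(a) = a·x - x·a` for some fixed `x`. -/
def IsInner (M : BanachBimodule 𝕜 A X) (D : A →L[𝕜] X) : Prop :=
  ∃ x : X, ∀ a : A, D a = M.lact a x - M.ract a x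

end BanachBimodule

/-- Amenability: for every Banach `A`-bimodule `X`, every bounded derivation
`A → X*` is inner. -/
def IsAmenable (𝕜 : Type v) [RCLike 𝕜] (A : Type u) [NonUnitalNormedRing A] [NormedSpace 𝕜 A] :
    Prop :=
  ∀ (X : Type (max u v)) [NormedAddCommGroup X] [NormedSpace 𝕜 X] [CompleteSpace X]
    (M : BanachBimodule 𝕜 A X) (D : A →L[𝕜] StrongDual 𝕜 X),
    M.dual.IsDerivation D → M.dual.IsInner D

/-- Arens regularity: the two Arens products on `A**` coincide. -/
def IsArensRegular (𝕜 : Type v) [RCLike 𝕜] (A : Type u) [NonUnitalNormedRing A] [NormedSpace 𝕜 A]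
    [IsScalarTower 𝕜 A A] [SMulCommClass 𝕜 A A] : Prop :=
  ∀ Φ Ψ : Bidual 𝕜 A, Bidual.firstMul 𝕜 A Φ Ψ = Bidual.secondMul 𝕜 A Φ Ψ

/-- The canonical image of `A` is a two-sided ideal of `A**` (it is always a linear subspace). -/
def IsIdealInBidual (𝕜 : Type v) [RCLike 𝕜] (A : Type u) [NonUnitalNormedRing A]
    [NormedSpace 𝕜 A] [IsScalarTower 𝕜 A A] [SMulCommClass 𝕜 A A] : Prop :=
  ∀ (Φ : Bidual 𝕜 A) (a : A),
    Φ * Bidual.incl 𝕜 A a ∈ Set.range (Bidual.incl 𝕜 A) ∧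
      Bidual.incl 𝕜 A a * Φ ∈ Set.range (Bidual.incl 𝕜 A)

/-- Reflexivity: the canonical embedding `A → A**` is onto. -/
def IsReflexiveSpace (𝕜 : Type v) [RCLike 𝕜] (A : Type u) [NormedAddCommGroup A]
    [NormedSpace 𝕜 A] : Prop :=
  Function.Surjective (NormedSpace.inclusionInDoubleDual 𝕜 A)

end

/-! Write `B = A**`. Turning off one action on `B*` makes the canonical map `B → B**` a derivation,
and amenability then yields `Φ ∈ B**` with `Φ(b·f) = f(b)`. Since `B` is itself a dual space,
restricting `Φ` to the canonical copy of `A*` in `B*` gives an element `e` of `B`, a genuine left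
identity. Then `e □ Φ = Φ` for all `Φ ∈ B**`, so the ideal hypothesis forces `B** = B`. Reflexivity
descends from `B` to its closed subspace `A`. -/

/-- The `A`-bimodule `A*` with left action `(a·f)(b) = f(ba)` and zero right action. -/
noncomputable def BanachBimodule.dualLeftRegular (𝕜 : Type*) [RCLike 𝕜] (A : Type*) [NonUnitalNormedRing A]
    [NormedSpace 𝕜 A] [IsScalarTower 𝕜 A A] [SMulCommClass 𝕜 A A] :
    BanachBimodule 𝕜 A (StrongDual 𝕜 A) where
  lact := (ArensProduct.adjoint (ContinuousLinearMap.mul 𝕜 A).flip).flip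
  ract := 0
  lact_mul a b f := ContinuousLinearMap.ext fun x => congrArg f (mul_assoc x a b).symm
  ract_mul _ _ _ := rfl
  lact_ract a _ _ :=
    map_zero ((ArensProduct.adjoint (ContinuousLinearMap.mul 𝕜 A).flip).flip a)

theorem BanachBimodule.dualLeftRegular_lact_apply {𝕜 : Type*} [RCLike 𝕜] {A : Type*}
    [NonUnitalNormedRing A] [NormedSpace 𝕜 A] [IsScalarTower 𝕜 A A] [SMulCommClass 𝕜 A A]
    (a b : A) (f : StrongDual 𝕜 A) : (dualLeftRegular 𝕜 A).lact a f b = f (b * a) := rfl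

/-- The second dual of an amenable Banach algebra has an element `Φ` with `Φ(a·f) = f(a)`, that
is, a left identity for `A` with respect to the second Arens product. -/
theorem IsAmenable.exists_bidual_left_identity {𝕜 : Type v} [RCLike 𝕜] {A : Type u}
    [NonUnitalNormedRing A] [NormedSpace 𝕜 A] [IsScalarTower 𝕜 A A] [SMulCommClass 𝕜 A A]
    (h : IsAmenable 𝕜 A) :
    ∃ Φ : StrongDual 𝕜 (StrongDual 𝕜 A), ∀ (a : A) (f : StrongDual 𝕜 A),
      Φ ((BanachBimodule.dualLeftRegular 𝕜 A).lact a f) = f a := by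
  -- The zero right action on `A*` becomes a zero left action on `A**`, so the derivation rule
  -- reduces to `D(ab) = D(a)·b`.
  have hD : (BanachBimodule.dualLeftRegular 𝕜 A).dual.IsDerivation
      (NormedSpace.inclusionInDoubleDual 𝕜 A) := by
    intro a b
    ext f
    rw [add_apply, BanachBimodule.dual_ract_apply,
      BanachBimodule.dual_lact_apply]
    change f (a * b) = f (a * b) + NormedSpace.inclusionInDoubleDual 𝕜 A b 0
    rw [map_zero, add_zero]
  obtain ⟨φ, hφ⟩ := h (StrongDual 𝕜 A) _ _ hD
  -- With `a·φ = 0`, innerness reads `D(a) = -φ·a`; hence the sign.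
  refine ⟨-φ, fun a f => ?_⟩
  have key := DFunLike.congr_fun (hφ a) f
  rw [sub_apply, BanachBimodule.dual_ract_apply,
    BanachBimodule.dual_lact_apply] at key
  change f a = φ 0 - _ at key
  rw [map_zero, zero_sub] at key
  exact key.symm

/-- If `A**` with the first Arens product is amenable, it has a left identity. -/
theorem Bidual.exists_left_identity {𝕜 : Type v} [RCLike 𝕜] {A : Type u} [NonUnitalNormedRing A]
    [NormedSpace 𝕜 A] [IsScalarTower 𝕜 A A] [SMulCommClass 𝕜 A A]
    (h : IsAmenable 𝕜 (Bidual 𝕜 A)) : ∃ e : Bidual 𝕜 A, ∀ Ψ : Bidual 𝕜 A, e * Ψ = Ψ := by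
  obtain ⟨Φ, hΦ⟩ := h.exists_bidual_left_identity
  let J : StrongDual 𝕜 A →L[𝕜] StrongDual 𝕜 (Bidual 𝕜 A) :=
    NormedSpace.inclusionInDoubleDual 𝕜 (StrongDual 𝕜 A)
  refine ⟨(Φ.comp J : StrongDual 𝕜 (StrongDual 𝕜 A)), fun Ψ => ?_⟩
  -- `Ψ·(J g)` and `J (Ψ·g)` agree by definition: both send `Θ` to `(Θ □ Ψ)(g) = Θ(Ψ·g)`.
  exact ContinuousLinearMap.ext fun g => hΦ Ψ (J g)

/-- A Banach algebra with a left identity that is an ideal in its second dual is reflexive. -/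
theorem IsIdealInBidual.isReflexiveSpace {𝕜 : Type*} [RCLike 𝕜] {A : Type*}
    [NonUnitalNormedRing A] [NormedSpace 𝕜 A] [IsScalarTower 𝕜 A A] [SMulCommClass 𝕜 A A]
    (h : IsIdealInBidual 𝕜 A) {e : A} (he : ∀ a : A, e * a = a) : IsReflexiveSpace 𝕜 A := by
  intro Φ
  have hΦ : Bidual.incl 𝕜 A e * (show Bidual 𝕜 A from Φ) = Φ := by
    refine ContinuousLinearMap.ext fun f => ?_
    -- Evaluating at `e` unfolds the product to `Φ(f·e)`, and `f·e = f` because `f(ea) = f(a)`.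
    refine congrArg (DFunLike.coe (F := StrongDual 𝕜 (StrongDual 𝕜 A)) Φ) ?_
    exact ContinuousLinearMap.ext fun a => congrArg f (he a)
  obtain ⟨a, ha⟩ := (h Φ e).2
  exact ⟨a, ha.trans hΦ⟩

/-- A Banach space with reflexive second dual is reflexive. -/
theorem IsReflexiveSpace.of_bidual {𝕜 : Type*} [RCLike 𝕜] {A : Type*} [NormedAddCommGroup A]
    [NormedSpace 𝕜 A] [CompleteSpace A] (h : IsReflexiveSpace 𝕜 (StrongDual 𝕜 (StrongDual 𝕜 A))) :
    IsReflexiveSpace 𝕜 A := by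
  intro Φ
  let J : A →L[𝕜] StrongDual 𝕜 (StrongDual 𝕜 A) := NormedSpace.inclusionInDoubleDual 𝕜 A
  -- An isometric image of a complete space is closed; this makes the quotient by `J.range` a normed
  -- space, where Hahn–Banach separates points.
  have hJ : Isometry J := (NormedSpace.inclusionInDoubleDualLi 𝕜 (E := A)).isometry
  have hclosed : IsClosed (J.range : Set (StrongDual 𝕜 (StrongDual 𝕜 A))) := by
    rw [LinearMap.coe_range]
    exact hJ.isClosedEmbedding.isClosed_range
  let T : StrongDual 𝕜 (StrongDual 𝕜 (StrongDual 𝕜 A)) →L[𝕜] StrongDual 𝕜 A :=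
    (ContinuousLinearMap.compL 𝕜 A (StrongDual 𝕜 (StrongDual 𝕜 A)) 𝕜).flip J
  -- `Φ.comp T` is the image of `Φ` under the bitranspose of `J`. Testing its representative `Ψ` on
  -- functionals coming from `A*` shows `Ψ = Φ`.
  obtain ⟨Ψ, hΨ⟩ := h (Φ.comp T)
  have hΨ' : ∀ F : StrongDual 𝕜 (StrongDual 𝕜 (StrongDual 𝕜 A)), F Ψ = Φ (F.comp J) :=
    fun F => DFunLike.congr_fun hΨ F
  have hΨΦ : Ψ = Φ := ContinuousLinearMap.ext fun f =>
    hΨ' (NormedSpace.inclusionInDoubleDual 𝕜 (StrongDual 𝕜 A) f)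
  subst hΨΦ
  by_contra hmem
  have hmk : J.range.mkQL Ψ ≠ 0 := fun h0 =>
    hmem ((Submodule.Quotient.mk_eq_zero J.range).1 h0)
  -- Pulled back along the quotient map, `G` kills `J.range` but not `Ψ`, against `F Ψ = Ψ (F.comp
  -- J)`.
  obtain ⟨G, hG⟩ := SeparatingDual.exists_ne_zero (R := 𝕜) hmk
  refine hG ?_
  have hzero : (G.comp J.range.mkQL).comp J = 0 := ContinuousLinearMap.ext fun a => by
    have hJa : J.range.mkQL (J a) = 0 := (Submodule.Quotient.mk_eq_zero J.range).2 ⟨a, rfl⟩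
    change G (J.range.mkQL (J a)) = 0
    rw [hJa, map_zero]
  have key := hΨ' (G.comp J.range.mkQL)
  rwa [hzero, map_zero] at key

theorem corollary1p2 {𝕜 : Type v} [RCLike 𝕜] {A : Type u} [NonUnitalNormedRing A]
    [NormedSpace 𝕜 A] [IsScalarTower 𝕜 A A] [SMulCommClass 𝕜 A A] [CompleteSpace A]
    (hamen : IsAmenable 𝕜 (Bidual 𝕜 A))
    (hreg : IsArensRegular 𝕜 (Bidual 𝕜 A))
    (hideal : IsIdealInBidual 𝕜 (Bidual 𝕜 A)) :
    IsReflexiveSpace 𝕜 A := by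
  obtain ⟨e, he⟩ := Bidual.exists_left_identity hamen
  exact IsReflexiveSpace.of_bidual (hideal.isReflexiveSpace he)
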